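/- Let $n\ge 2$, $\bar v>0$ and $m\in(0,\bar v)^n$. One indivisible object may be sold to one of $n$ bidders whose value profile is $v\in[0,\bar v]^n$. Let $\mathcal M$ be the set of direct deterministic mechanisms $M=(x_i,t_i)_{i=1}^n$, with measurable $x_i:[0,\bar v]^n\to\{0,1\}$, $\sum_i x_i\le 1$, and measurable $t_i:[0,\bar v]^n\to\mathbb R$, that are dominant-strategy incentive compatible and ex post individually rational. Write $t^M=\sum_i t_i$ and $R(M,F)=\int t^M\,dF\in[-\infty,\infty)$. Let $\Delta_{=}$ (respectively $\Delta_{\ge}$) be the set of all Borel probability distributions $F$ on $[0,\bar v]^n$ with $\int v_i\,dF=m_i$ for all $i$ (respectively $\int v_i\,dF\ge m_i$ for all $i$). For $\Delta\in\{\Delta_=,\Delta_\ge\}$ call $M\in\mathcal M$ optimal for $\Delta$ if it maximizes the revenue guarantee $\inf_{F\in\Delta}R(M,F)$ over $\mathcal M$. Then the set of mechanisms that are optimal for $\Delta_=$ equals the set of mechanisms that are optimal for $\Delta_\ge$. Moreover, for every mechanism $M$ that is optimal for $\Delta_=$, the dual problem $$\sup_{\lambda\in\mathbb R^n}\Big(\sum_i\lambda_i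 m_i+\inf_{v\in[0,\bar v]^n}\Big\{t^M(v)-\sum_i\lambda_i v_i\Big\}\Big)$$ has a maximizer, and every maximizer $\lambda^*$ satisfies $\lambda^*_i\ge 0$ for all $i$. -/

import Mathlib

open MeasureTheory

noncomputable section

namespace RobustAuction

/-- Value profiles, i.e. points of the cube `[0, a]ⁿ` (with its Borel = product sigma-algebra). -/
abbrev Profile (n : ℕ) (a : ℝ) : Type := Fin n → Set.Icc (0 : ℝ) a

/-- A direct deterministic mechanism for one indivisible object: measurable allocation functions
with values in `{0, 1}` whose sum is at most one, and measurable real-valued transfers. -/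
structure DirectMechanism (n : ℕ) (a : ℝ) where
  x : Fin n → Profile n a → ℝ
  t : Fin n → Profile n a → ℝ
  measurable_x : ∀ i, Measurable (x i)
  measurable_t : ∀ i, Measurable (t i)
  deterministic : ∀ i v, x i v = 0 ∨ x i v = 1
  supply : ∀ v, ∑ i, x i v ≤ 1

namespace DirectMechanism

variable {n : ℕ} {a : ℝ}

/-- Ex post utility of bidder `i` whose true value is `w` when the reported profile is `r`. -/
def utility (M : DirectMechanism n a) (i : Fin n) (w : Set.Icc (0 : ℝ) a) (r : Profile n a) : ℝ :=
  (w : ℝ) * M.x i r - M.t i r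

/-- Dominant-strategy incentive compatibility: whatever the others report, no bidder gains by
reporting some `w` instead of her true value `v i`. -/
def IsDSIC (M : DirectMechanism n a) : Prop :=
  ∀ (i : Fin n) (v : Profile n a) (w : Set.Icc (0 : ℝ) a),
    M.utility i (v i) (Function.update v i w) ≤ M.utility i (v i) v

/-- Ex post individual rationality. -/
def IsEPIR (M : DirectMechanism n a) : Prop :=
  ∀ (i : Fin n) (v : Profile n a), 0 ≤ M.utility i (v i) v

/-- The total transfer `∑ᵢ tᵢ(v)` received by the seller. -/
def totalTransfer (M : DirectMechanism n a) (v : Profile n a) : ℝ := ∑ i, M.t i v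

/-- Expected revenue `∫ ∑ᵢ tᵢ dF`, as an extended real: integral of the positive part minus
integral of the negative part. For a DSIC and ex post IR mechanism the total transfer is at most
`a`, so the first term is finite and the difference is meaningful; it is `-∞` exactly if
the negative part has infinite integral. -/
def revenue (M : DirectMechanism n a) (F : Measure (Profile n a)) : EReal :=
  ((∫⁻ v, ENNReal.ofReal (M.totalTransfer v) ∂F : ENNReal) : EReal)
    - ((∫⁻ v, ENNReal.ofReal (-M.totalTransfer v) ∂F : ENNReal) : EReal)

/-- Worst-case expected revenue over a set `D` of distributions. -/
def guarantee (M : DirectMechanism n a) (D : Set (Measure (Profile n a))) : EReal :=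
  ⨅ F ∈ D, M.revenue F

/-- The objective of the dual of Nature's problem with mean constraints `E(v) = m`:
`lam · m + inf_v (∑ᵢ tᵢ(v) - lam · v)`, the infimum being over all of `[0, a]ⁿ`. -/
def dualValue (M : DirectMechanism n a) (m lam : Fin n → ℝ) : EReal :=
  ((∑ i, lam i * m i : ℝ) : EReal)
    + ⨅ v : Profile n a, ((M.totalTransfer v - ∑ i, lam i * (v i : ℝ) : ℝ) : EReal)

/-- `lam` is a vector of optimal dual variables for `M`: it maximizes the dual objective over all
of `ℝⁿ` (with no sign restriction). -/
def IsDualMultiplier (M : DirectMechanism n a) (m lam : Fin n → ℝ) : Prop :=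
  ∀ mu : Fin n → ℝ, M.dualValue m mu ≤ M.dualValue m lam

end DirectMechanism

/-- The class of DSIC and ex post IR deterministic mechanisms. -/
def admissible (n : ℕ) (a : ℝ) : Set (DirectMechanism n a) :=
  {M | M.IsDSIC ∧ M.IsEPIR}

/-- Borel distributions on `[0, a]ⁿ` with `E(v) = m`. -/
def meansEqual {n : ℕ} (a : ℝ) (m : Fin n → ℝ) : Set (Measure (Profile n a)) :=
  {F | IsProbabilityMeasure F ∧ ∀ i, ∫ v, (v i : ℝ) ∂F = m i}

/-- Borel distributions on `[0, a]ⁿ` with `E(v) ≥ m` (componentwise). -/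
def meansAtLeast {n : ℕ} (a : ℝ) (m : Fin n → ℝ) : Set (Measure (Profile n a)) :=
  {F | IsProbabilityMeasure F ∧ ∀ i, m i ≤ ∫ v, (v i : ℝ) ∂F}

/-- Maxmin-optimal mechanisms when the seller only knows that the distribution of values is in
`D`: the maximizers of worst-case expected revenue among admissible mechanisms. -/
def optimalMechanisms {n : ℕ} {a : ℝ} (D : Set (Measure (Profile n a))) :
    Set (DirectMechanism n a) :=
  {M | M ∈ admissible n a ∧ ∀ M' ∈ admissible n a, M'.guarantee D ≤ M.guarantee D}

end RobustAuction

end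

open MeasureTheory

namespace RobustAuction

namespace DirectMechanism

variable {n : ℕ} {a : ℝ}

/-! An affine minorant `c + λ·v` of the total transfer guarantees revenue `c + λ·m` over
`meansEqual`, and also over `meansAtLeast` when `λ ≥ 0`. Since `m` is interior, a nonnegative
guarantee over `meansEqual` is attained by such a minorant (`exists_guarantee_eq_and_affine_le`).

If some `λ j < 0`, exclude the bidders with negative coefficients and treat them as reporting zero.
By individual rationality this loses no revenue at the zeroed profile, so `c + λ⁺·v` is a minorant
for the new mechanism (`exists_admissible_affine_posPart_le`), strictly larger at `m`. Hence
optimality over `meansEqual` forces `λ ≥ 0`, and both guarantees agree. Conversely, a mechanism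
doing better over `meansEqual` could be modified in this way to do better over `meansAtLeast`. -/

theorem measurable_totalTransfer (M : DirectMechanism n a) : Measurable M.totalTransfer :=
  Finset.measurable_sum _ fun i _ => M.measurable_t i

theorem x_nonneg (M : DirectMechanism n a) (i : Fin n) (v : Profile n a) : 0 ≤ M.x i v := by
  rcases M.deterministic i v with h | h <;> simp [h]

/-- Under ex post individual rationality the total transfer never exceeds the top value. -/
theorem IsEPIR.totalTransfer_le {M : DirectMechanism n a} (hM : M.IsEPIR) (ha : 0 ≤ a)
    (v : Profile n a) : M.totalTransfer v ≤ a := by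
  calc M.totalTransfer v ≤ ∑ i, a * M.x i v := by
        refine Finset.sum_le_sum fun i _ => ?_
        have h1 := hM i v
        have h2 := mul_le_mul_of_nonneg_right (v i).2.2 (M.x_nonneg i v)
        unfold utility at h1
        linarith
    _ = a * ∑ i, M.x i v := by rw [Finset.mul_sum]
    _ ≤ a := by nlinarith [M.supply v]

theorem revenue_eq_integral (M : DirectMechanism n a) {F : Measure (Profile n a)}
    (h : Integrable M.totalTransfer F) :
    M.revenue F = ((∫ v, M.totalTransfer v ∂F : ℝ) : EReal) := by
  have h1 : ∫⁻ v, ENNReal.ofReal (M.totalTransfer v) ∂F ≠ ⊤ :=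
    h.lintegral_lt_top.ne
  have h2 : ∫⁻ v, ENNReal.ofReal (-M.totalTransfer v) ∂F ≠ ⊤ :=
    h.neg.lintegral_lt_top.ne
  rw [integral_eq_lintegral_pos_part_sub_lintegral_neg_part h, EReal.coe_sub,
    EReal.coe_ennreal_toReal h1, EReal.coe_ennreal_toReal h2, revenue]

end DirectMechanism

open DirectMechanism

variable {n : ℕ} {a : ℝ}

theorem measurable_value (i : Fin n) : Measurable fun v : Profile n a => (v i : ℝ) :=
  measurable_subtype_coe.comp (measurable_pi_apply i)

theorem integrable_value (F : Measure (Profile n a)) [IsFiniteMeasure F] (i : Fin n) :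
    Integrable (fun v : Profile n a => (v i : ℝ)) F := by
  refine Integrable.of_bound (measurable_value i).aestronglyMeasurable a (ae_of_all _ fun v => ?_)
  rw [Real.norm_of_nonneg (v i).2.1]
  exact (v i).2.2

theorem integrable_affine (F : Measure (Profile n a)) [IsFiniteMeasure F] (c : ℝ)
    (lam : Fin n → ℝ) : Integrable (fun v : Profile n a => c + ∑ i, lam i * (v i : ℝ)) F :=
  (integrable_const c).add (integrable_finsetSum _ fun i _ => (integrable_value F i).const_mul _)

theorem integral_affine (F : Measure (Profile n a)) [IsProbabilityMeasure F] (c : ℝ)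
    (lam : Fin n → ℝ) :
    ∫ v : Profile n a, (c + ∑ i, lam i * (v i : ℝ)) ∂F
      = c + ∑ i, lam i * ∫ v, (v i : ℝ) ∂F := by
  rw [integral_add (integrable_const c)
    (integrable_finsetSum _ fun i _ => (integrable_value F i).const_mul _),
    integral_finsetSum _ fun i _ => (integrable_value F i).const_mul _]
  simp [integral_const_mul]

/-! ### Affine minorants and weak duality -/

theorem affine_le_revenue {M : DirectMechanism n a} (hM : M.IsEPIR) (ha : 0 ≤ a) {c : ℝ}
    {lam : Fin n → ℝ} (h : ∀ v : Profile n a, c + ∑ i, lam i * (v i : ℝ) ≤ M.totalTransfer v)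
    (F : Measure (Profile n a)) [IsProbabilityMeasure F] :
    ((c + ∑ i, lam i * ∫ v, (v i : ℝ) ∂F : ℝ) : EReal) ≤ M.revenue F := by
  -- Transfers may be unbounded below in general; the minorant supplies the lower bound, individual
  -- rationality the upper bound `a`.
  have hint : Integrable M.totalTransfer F :=
    integrable_of_le_of_le M.measurable_totalTransfer.aestronglyMeasurable
      (ae_of_all _ h) (ae_of_all _ (hM.totalTransfer_le ha)) (integrable_affine F c lam)
      (integrable_const a)
  rw [M.revenue_eq_integral hint, EReal.coe_le_coe_iff, ← integral_affine]
  exact integral_mono (integrable_affine F c lam) hint h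

theorem affine_le_guarantee_meansEqual {M : DirectMechanism n a} (hM : M.IsEPIR) (ha : 0 ≤ a)
    {c : ℝ} {lam : Fin n → ℝ}
    (h : ∀ v : Profile n a, c + ∑ i, lam i * (v i : ℝ) ≤ M.totalTransfer v) (m : Fin n → ℝ) :
    ((c + ∑ i, lam i * m i : ℝ) : EReal) ≤ M.guarantee (meansEqual a m) := by
  refine le_iInf₂ fun F hF => ?_
  have := hF.1
  have h1 := affine_le_revenue hM ha h F
  simpa only [hF.2] using h1

theorem affine_le_guarantee_meansAtLeast {M : DirectMechanism n a} (hM : M.IsEPIR) (ha : 0 ≤ a)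
    {c : ℝ} {lam : Fin n → ℝ} (hlam : ∀ i, 0 ≤ lam i)
    (h : ∀ v : Profile n a, c + ∑ i, lam i * (v i : ℝ) ≤ M.totalTransfer v) (m : Fin n → ℝ) :
    ((c + ∑ i, lam i * m i : ℝ) : EReal) ≤ M.guarantee (meansAtLeast a m) := by
  refine le_iInf₂ fun F hF => ?_
  have := hF.1
  refine le_trans ?_ (affine_le_revenue hM ha h F)
  rw [EReal.coe_le_coe_iff]
  gcongr with i
  · exact hlam i
  · exact hF.2 i

theorem guarantee_meansAtLeast_le (M : DirectMechanism n a) (m : Fin n → ℝ) :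
    M.guarantee (meansAtLeast a m) ≤ M.guarantee (meansEqual a m) :=
  biInf_mono fun _ hF => ⟨hF.1, fun i => (hF.2 i).ge⟩

theorem le_dualValue {M : DirectMechanism n a} {c : ℝ} {lam : Fin n → ℝ}
    (h : ∀ v : Profile n a, c + ∑ i, lam i * (v i : ℝ) ≤ M.totalTransfer v) (m : Fin n → ℝ) :
    ((c + ∑ i, lam i * m i : ℝ) : EReal) ≤ M.dualValue m lam := by
  rw [add_comm, EReal.coe_add]
  refine add_le_add le_rfl (le_iInf fun v => ?_)
  rw [EReal.coe_le_coe_iff]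
  linarith [h v]

theorem affine_le_of_le_dualValue {M : DirectMechanism n a} {g : ℝ} {m lam : Fin n → ℝ}
    (h : (g : EReal) ≤ M.dualValue m lam) (v : Profile n a) :
    (g - ∑ i, lam i * m i) + ∑ i, lam i * (v i : ℝ) ≤ M.totalTransfer v := by
  have h1 : (g : EReal) ≤ ((∑ i, lam i * m i : ℝ) : EReal)
      + ((M.totalTransfer v - ∑ i, lam i * (v i : ℝ) : ℝ) : EReal) :=
    h.trans (add_le_add le_rfl (iInf_le _ v))
  rw [← EReal.coe_add, EReal.coe_le_coe_iff] at h1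
  linarith

/-- Weak duality. -/
theorem dualValue_le_guarantee {M : DirectMechanism n a} (hM : M.IsEPIR) (ha : 0 ≤ a)
    (m lam : Fin n → ℝ) : M.dualValue m lam ≤ M.guarantee (meansEqual a m) := by
  -- Testing only real `g` below the dual value avoids a separate case for `-∞`.
  refine EReal.ge_of_forall_gt_iff_ge.mp fun g hg => ?_
  have h := affine_le_guarantee_meansEqual hM ha (affine_le_of_le_dualValue hg.le) m
  simpa using h

/-! ### Strong duality by separation -/

/-- The attainable pairs of a mean vector and an upper bound on expected revenue. -/
def attainable (M : DirectMechanism n a) : Set ((Fin n → ℝ) × ℝ) :=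
  {p | ∃ F : Measure (Profile n a), IsProbabilityMeasure F ∧ (∀ i, ∫ v, (v i : ℝ) ∂F = p.1 i) ∧
    Integrable M.totalTransfer F ∧ ∫ v, M.totalTransfer v ∂F ≤ p.2}

theorem convex_attainable (M : DirectMechanism n a) : Convex ℝ (attainable M) := by
  rintro ⟨p, r⟩ ⟨F, hF, hp, hFi, hr⟩ ⟨q, s⟩ ⟨H, hH, hq, hHi, hs⟩ b c hb hc hbc
  refine ⟨ENNReal.ofReal b • F + ENNReal.ofReal c • H, ⟨?_⟩, fun i => ?_, ?_, ?_⟩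
  · simp [← ENNReal.ofReal_add hb hc, hbc]
  · rw [integral_add_measure ((integrable_value F i).smul_measure ENNReal.ofReal_ne_top)
      ((integrable_value H i).smul_measure ENNReal.ofReal_ne_top), integral_smul_measure,
      integral_smul_measure, hp, hq, ENNReal.toReal_ofReal hb, ENNReal.toReal_ofReal hc]
    rfl
  · exact (hFi.smul_measure ENNReal.ofReal_ne_top).add_measure
      (hHi.smul_measure ENNReal.ofReal_ne_top)
  · rw [integral_add_measure (hFi.smul_measure ENNReal.ofReal_ne_top)
      (hHi.smul_measure ENNReal.ofReal_ne_top), integral_smul_measure,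
      integral_smul_measure, ENNReal.toReal_ofReal hb, ENNReal.toReal_ofReal hc]
    exact add_le_add (mul_le_mul_of_nonneg_left hr hb) (mul_le_mul_of_nonneg_left hs hc)

theorem mem_attainable (M : DirectMechanism n a) (v : Profile n a) {s : ℝ}
    (hs : M.totalTransfer v ≤ s) : ((fun i => (v i : ℝ)), s) ∈ attainable M := by
  refine ⟨Measure.dirac v, inferInstance, fun i => ?_, ?_, ?_⟩
  · exact integral_dirac' _ _ (measurable_value i).stronglyMeasurable
  · refine integrable_dirac' M.measurable_totalTransfer.stronglyMeasurable ?_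
    simp
  · rwa [integral_dirac' _ _ M.measurable_totalTransfer.stronglyMeasurable]

/-- Point masses already attain these pairs, because the total transfer is at most `a`. The
resulting interior points rule out a vertical separating hyperplane. -/
theorem openCube_prod_Ioi_subset_interior {M : DirectMechanism n a} (hM : M.IsEPIR)
    (ha : 0 ≤ a) : (Set.univ.pi fun _ : Fin n => Set.Ioo 0 a) ×ˢ Set.Ioi a
      ⊆ interior (attainable M) := by
  refine interior_maximal ?_
    ((isOpen_set_pi Set.finite_univ fun _ _ => isOpen_Ioo).prod isOpen_Ioi)
  rintro ⟨p, s⟩ ⟨hp, hs⟩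
  exact mem_attainable M (fun i => ⟨p i, Set.Ioo_subset_Icc_self (hp i trivial)⟩)
    ((hM.totalTransfer_le ha _).trans (le_of_lt hs))

/-- Strong duality: if the guarantee over distributions with interior mean vector `m` is finite,
then some affine minorant of the total transfer attains it at `m`. -/
theorem exists_affine_le_of_guarantee_eq {M : DirectMechanism n a} (hM : M.IsEPIR) (ha : 0 ≤ a)
    {m : Fin n → ℝ} (hm : ∀ i, 0 < m i ∧ m i < a) {g : ℝ}
    (hg : M.guarantee (meansEqual a m) = g) :
    ∃ lam : Fin n → ℝ, ∀ v : Profile n a,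
      (g - ∑ i, lam i * m i) + ∑ i, lam i * (v i : ℝ) ≤ M.totalTransfer v := by
  have hle : ∀ s, (m, s) ∈ attainable M → g ≤ s := by
    rintro s ⟨F, hF, hmean, hint, hs⟩
    have h1 : M.guarantee (meansEqual a m) ≤ M.revenue F := iInf₂_le F ⟨hF, hmean⟩
    rw [hg, M.revenue_eq_integral hint, EReal.coe_le_coe_iff] at h1
    exact h1.trans hs
  -- Otherwise some `(m, s)` with `s < g` would be attainable.
  have hnot : (m, g) ∉ interior (attainable M) := by
    intro hmem
    have hcont : ContinuousAt (fun s : ℝ => (m, s)) g := by fun_prop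
    have hev := hcont.eventually (mem_interior_iff_mem_nhds.mp hmem)
    obtain ⟨s, hs, hlt⟩ := ((hev.filter_mono nhdsWithin_le_nhds).and
      (self_mem_nhdsWithin : Set.Iio g ∈ nhdsWithin g (Set.Iio g))).exists
    exact absurd (hle s hs) (not_le.mpr hlt)
  obtain ⟨f, hf⟩ := geometric_hahn_banach_open_point (convex_attainable M).interior
    isOpen_interior hnot
  have htop : (m, max a g + 1) ∈ interior (attainable M) :=
    openCube_prod_Ioi_subset_interior hM ha
      ⟨fun i _ => hm i, lt_of_le_of_lt (le_max_left a g) (lt_add_one _)⟩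
  -- A convex set with nonempty interior lies in the closure of that interior, so the separation
  -- extends weakly to the whole set.
  have hclosed : ∀ p ∈ attainable M, f p ≤ f (m, g) := by
    intro p hp
    have hp' : p ∈ closure (interior (attainable M)) := by
      rw [(convex_attainable M).closure_interior_eq_closure_of_nonempty_interior ⟨_, htop⟩]
      exact subset_closure hp
    exact closure_minimal (fun q hq => (hf q hq).le)
      (isClosed_le f.continuous continuous_const) hp'
  set β := f (0, 1) with hβ
  set α : Fin n → ℝ := fun i => f (Pi.single i 1, 0) with hα
  have hf_eq : ∀ (p : Fin n → ℝ) (s : ℝ), f (p, s) = ∑ i, α i * p i + β * s := by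
    intro p s
    have h1 : (p, s) = ∑ i, p i • ((Pi.single i 1, 0) : (Fin n → ℝ) × ℝ)
        + s • ((0, 1) : (Fin n → ℝ) × ℝ) := by
      ext j
      · simp [Prod.fst_sum, Finset.sum_apply, Pi.single_apply]
      · simp [Prod.snd_sum]
    rw [h1, map_add, map_sum, map_smul]
    simp only [map_smul, smul_eq_mul, hα, hβ, mul_comm]
  -- The point of `htop` lies directly above `(m, g)`, so only the last coordinate distinguishes
  -- their values under `f`.
  have hβneg : β < 0 := by
    have h1 := hf _ htop
    rw [hf_eq, hf_eq] at h1
    nlinarith [le_max_right a g]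
  refine ⟨fun i => α i / (-β), fun v => ?_⟩
  have h1 := hclosed _ (mem_attainable M v le_rfl)
  rw [hf_eq, hf_eq] at h1
  have h2 : ∀ p : Fin n → ℝ, ∑ i, α i / (-β) * p i = (∑ i, α i * p i) / (-β) := fun p => by
    rw [Finset.sum_div]
    exact Finset.sum_congr rfl fun i _ => by ring
  rw [h2, h2 fun i => (v i : ℝ)]
  have hpos : 0 < -β := by linarith
  have h3 : (∑ i, α i * (v i : ℝ) - ∑ i, α i * m i) / (-β) ≤ M.totalTransfer v - g := by
    rw [div_le_iff₀ hpos]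
    linarith
  rw [sub_div] at h3
  linarith

/-! ### Excluding bidders -/

/-- Replace the values of the bidders in `J` by zero. -/
def zeroOn (ha : 0 ≤ a) (J : Set (Fin n)) [DecidablePred (· ∈ J)] (v : Profile n a) :
    Profile n a := fun i => if i ∈ J then ⟨0, le_rfl, ha⟩ else v i

theorem measurable_zeroOn (ha : 0 ≤ a) (J : Set (Fin n)) [DecidablePred (· ∈ J)] :
    Measurable (zeroOn ha J) := by
  refine measurable_pi_lambda _ fun i => ?_
  by_cases hi : i ∈ J
  · simp only [zeroOn, hi, if_true]
    exact measurable_const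
  · simp only [zeroOn, hi, if_false]
    exact measurable_pi_apply i

theorem zeroOn_update (ha : 0 ≤ a) (J : Set (Fin n)) [DecidablePred (· ∈ J)] {i : Fin n}
    (hi : i ∉ J) (v : Profile n a) (w : Set.Icc (0 : ℝ) a) :
    zeroOn ha J (Function.update v i w) = Function.update (zeroOn ha J v) i w := by
  funext k
  rcases eq_or_ne k i with rfl | hk
  · simp [zeroOn, hi]
  · simp [zeroOn, hk]

/-- The mechanism that excludes the bidders in `J` and treats the others as if the excluded
bidders had reported zero. -/
def DirectMechanism.exclude (M : DirectMechanism n a) (ha : 0 ≤ a) (J : Set (Fin n))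
    [DecidablePred (· ∈ J)] : DirectMechanism n a where
  x i v := if i ∈ J then 0 else M.x i (zeroOn ha J v)
  t i v := if i ∈ J then 0 else M.t i (zeroOn ha J v)
  measurable_x i := by
    split_ifs
    · exact measurable_const
    · exact (M.measurable_x i).comp (measurable_zeroOn ha J)
  measurable_t i := by
    split_ifs
    · exact measurable_const
    · exact (M.measurable_t i).comp (measurable_zeroOn ha J)
  deterministic i v := by
    split_ifs
    · exact Or.inl rfl
    · exact M.deterministic i _
  supply v := by
    refine le_trans (Finset.sum_le_sum fun i _ => ?_) (M.supply (zeroOn ha J v))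
    split_ifs
    · exact M.x_nonneg i _
    · exact le_rfl

/-- Zeroing the others commutes with a remaining bidder's own deviation, so each constraint is one
of `M` at the zeroed profile. -/
theorem exclude_mem_admissible {M : DirectMechanism n a} (hM : M ∈ admissible n a) (ha : 0 ≤ a)
    (J : Set (Fin n)) [DecidablePred (· ∈ J)] : M.exclude ha J ∈ admissible n a := by
  have hz : ∀ {i : Fin n}, i ∉ J → ∀ v : Profile n a, zeroOn ha J v i = v i :=
    fun hi v => by simp [zeroOn, hi]
  refine ⟨fun i v w => ?_, fun i v => ?_⟩
  · by_cases hi : i ∈ J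
    · simp [utility, exclude, hi]
    · have h := hM.1 i (zeroOn ha J v) w
      rw [← zeroOn_update ha J hi, hz hi] at h
      simpa [utility, exclude, hi] using h
  · by_cases hi : i ∈ J
    · simp [utility, exclude, hi]
    · have h := hM.2 i (zeroOn ha J v)
      rw [hz hi] at h
      simpa [utility, exclude, hi] using h

/-- A bidder of value zero pays at most zero by individual rationality, so dropping her transfer
cannot reduce the total. -/
theorem totalTransfer_zeroOn_le {M : DirectMechanism n a} (hM : M.IsEPIR) (ha : 0 ≤ a)
    (J : Set (Fin n)) [DecidablePred (· ∈ J)] (v : Profile n a) :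
    M.totalTransfer (zeroOn ha J v) ≤ (M.exclude ha J).totalTransfer v := by
  refine Finset.sum_le_sum fun i _ => ?_
  by_cases hi : i ∈ J
  · have h := hM i (zeroOn ha J v)
    simp only [utility, zeroOn, hi, if_true, zero_mul] at h
    simp only [exclude, hi, if_true]
    simpa [zeroOn] using h
  · simp [exclude, hi]

/-- Excluding the bidders with negative coefficients improves an affine minorant of the total
transfer to the one with these coefficients replaced by zero. -/
theorem exists_admissible_affine_posPart_le {M : DirectMechanism n a} (hM : M ∈ admissible n a)
    (ha : 0 ≤ a) {c : ℝ} {lam : Fin n → ℝ}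
    (h : ∀ v : Profile n a, c + ∑ i, lam i * (v i : ℝ) ≤ M.totalTransfer v) :
    ∃ M' ∈ admissible n a, ∀ v : Profile n a,
      c + ∑ i, max (lam i) 0 * (v i : ℝ) ≤ M'.totalTransfer v := by
  classical
  refine ⟨M.exclude ha {i | lam i < 0}, exclude_mem_admissible hM ha _, fun v => ?_⟩
  refine le_trans (le_of_eq ?_) ((h _).trans (totalTransfer_zeroOn_le hM.2 ha _ v))
  congr 1
  refine Finset.sum_congr rfl fun i _ => ?_
  by_cases hi : lam i < 0
  · simp [zeroOn, hi, hi.le]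
  · simp [zeroOn, hi, not_lt.mp hi]

/-! ### Comparing the two optimality notions -/

theorem sum_mul_le_sum_posPart_mul {m : Fin n → ℝ} (hm : ∀ i, 0 < m i) (lam : Fin n → ℝ) :
    ∑ i, lam i * m i ≤ ∑ i, max (lam i) 0 * m i :=
  Finset.sum_le_sum fun i _ => mul_le_mul_of_nonneg_right (le_max_left _ _) (hm i).le

theorem sum_mul_lt_sum_posPart_mul {m : Fin n → ℝ} (hm : ∀ i, 0 < m i) {lam : Fin n → ℝ}
    {j : Fin n} (hj : lam j < 0) : ∑ i, lam i * m i < ∑ i, max (lam i) 0 * m i :=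
  Finset.sum_lt_sum (fun i _ => mul_le_mul_of_nonneg_right (le_max_left _ _) (hm i).le)
    ⟨j, Finset.mem_univ j, mul_lt_mul_of_pos_right (hj.trans_le (le_max_right _ _)) (hm j)⟩

/-- Never selling yields zero, so an optimal guarantee cannot be `-∞`. -/
theorem exists_admissible_affine_nonneg (n : ℕ) (a : ℝ) :
    ∃ M ∈ admissible n a, ∀ v : Profile n a,
      (0 : ℝ) + ∑ i, (0 : Fin n → ℝ) i * (v i : ℝ) ≤ M.totalTransfer v := by
  refine ⟨⟨fun _ _ => 0, fun _ _ => 0, fun _ => measurable_const, fun _ => measurable_const,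
    fun _ _ => Or.inl rfl, fun _ => by simp⟩, ⟨fun i v w => ?_, fun i v => ?_⟩, fun v => ?_⟩
  all_goals simp [utility, totalTransfer]

theorem guarantee_meansEqual_le {M : DirectMechanism n a} (hM : M.IsEPIR) (ha : 0 ≤ a)
    {m : Fin n → ℝ} (hm : ∀ i, 0 < m i ∧ m i < a) : M.guarantee (meansEqual a m) ≤ a := by
  obtain ⟨F, hF, hmean, hint, hs⟩ :=
    mem_attainable M (fun i => ⟨m i, (hm i).1.le, (hm i).2.le⟩) (hM.totalTransfer_le ha _)
  refine (iInf₂_le F ⟨hF, hmean⟩).trans ?_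
  rw [M.revenue_eq_integral hint]
  exact EReal.coe_le_coe_iff.mpr hs

/-- A mechanism with nonnegative guarantee has a real guarantee, attained by an affine minorant. -/
theorem exists_guarantee_eq_and_affine_le {M : DirectMechanism n a} (hM : M.IsEPIR) (ha : 0 ≤ a)
    {m : Fin n → ℝ} (hm : ∀ i, 0 < m i ∧ m i < a) (h0 : 0 ≤ M.guarantee (meansEqual a m)) :
    ∃ (g : ℝ) (lam : Fin n → ℝ), M.guarantee (meansEqual a m) = g ∧ ∀ v : Profile n a,
      (g - ∑ i, lam i * m i) + ∑ i, lam i * (v i : ℝ) ≤ M.totalTransfer v := by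
  have hg : M.guarantee (meansEqual a m) = (M.guarantee (meansEqual a m)).toReal :=
    (EReal.coe_toReal
      (ne_top_of_le_ne_top (EReal.coe_ne_top a) (guarantee_meansEqual_le hM ha hm))
      (ne_bot_of_le_ne_bot EReal.zero_ne_bot h0)).symm
  obtain ⟨lam, hlam⟩ := exists_affine_le_of_guarantee_eq hM ha hm hg
  exact ⟨_, lam, hg, hlam⟩

theorem guarantee_nonneg_of_mem_optimalMechanisms {M : DirectMechanism n a} (ha : 0 ≤ a)
    {m : Fin n → ℝ} (hM : M ∈ optimalMechanisms (meansEqual a m)) :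
    0 ≤ M.guarantee (meansEqual a m) := by
  obtain ⟨Z, hZ, hZt⟩ := exists_admissible_affine_nonneg n a
  have h := affine_le_guarantee_meansEqual hZ.2 ha hZt m
  exact le_trans (by simpa using h) (hM.2 Z hZ)

theorem guarantee_nonneg_of_mem_optimalMechanisms_meansAtLeast {M : DirectMechanism n a}
    (ha : 0 ≤ a) {m : Fin n → ℝ} (hM : M ∈ optimalMechanisms (meansAtLeast a m)) :
    0 ≤ M.guarantee (meansAtLeast a m) := by
  obtain ⟨Z, hZ, hZt⟩ := exists_admissible_affine_nonneg n a
  have h := affine_le_guarantee_meansAtLeast hZ.2 ha (fun _ => le_rfl) hZt m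
  exact le_trans (by simpa using h) (hM.2 Z hZ)

/-- An affine minorant attaining the guarantee of an optimal mechanism is nondecreasing. -/
theorem coeff_nonneg_of_mem_optimalMechanisms {M : DirectMechanism n a} (ha : 0 ≤ a)
    {m : Fin n → ℝ} (hm : ∀ i, 0 < m i) (hM : M ∈ optimalMechanisms (meansEqual a m)) {g : ℝ}
    (hg : M.guarantee (meansEqual a m) = g) {lam : Fin n → ℝ}
    (h : ∀ v : Profile n a,
      (g - ∑ i, lam i * m i) + ∑ i, lam i * (v i : ℝ) ≤ M.totalTransfer v) (j : Fin n) :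
    0 ≤ lam j := by
  by_contra! hj
  obtain ⟨M', hM', hM't⟩ := exists_admissible_affine_posPart_le hM.1 ha h
  have h1 := (affine_le_guarantee_meansEqual hM'.2 ha hM't m).trans (hM.2 M' hM')
  rw [hg, EReal.coe_le_coe_iff] at h1
  linarith [sum_mul_lt_sum_posPart_mul hm hj]

theorem optimalMechanisms_meansEqual_subset (ha : 0 ≤ a) {m : Fin n → ℝ}
    (hm : ∀ i, 0 < m i ∧ m i < a) :
    optimalMechanisms (meansEqual a m) ⊆ optimalMechanisms (meansAtLeast a m) := by
  intro M hM
  obtain ⟨g, lam, hg, hlam⟩ := exists_guarantee_eq_and_affine_le hM.1.2 ha hm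
    (guarantee_nonneg_of_mem_optimalMechanisms ha hM)
  have hpos := coeff_nonneg_of_mem_optimalMechanisms ha (fun i => (hm i).1) hM hg hlam
  have h := affine_le_guarantee_meansAtLeast hM.1.2 ha hpos hlam m
  rw [sub_add_cancel, ← hg] at h
  exact ⟨hM.1, fun M' hM' => (guarantee_meansAtLeast_le M' m).trans ((hM.2 M' hM').trans h)⟩

theorem optimalMechanisms_meansAtLeast_subset (ha : 0 ≤ a) {m : Fin n → ℝ}
    (hm : ∀ i, 0 < m i ∧ m i < a) :
    optimalMechanisms (meansAtLeast a m) ⊆ optimalMechanisms (meansEqual a m) := by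
  intro M hM
  refine ⟨hM.1, fun M' hM' => ?_⟩
  by_contra! hlt
  have h0 := (guarantee_nonneg_of_mem_optimalMechanisms_meansAtLeast ha hM).trans
    (guarantee_meansAtLeast_le M m)
  -- Strong duality applies to `M'`, optimal or not, since it beats a nonnegative guarantee.
  obtain ⟨g, lam, hg, hlam⟩ := exists_guarantee_eq_and_affine_le hM'.2 ha hm (h0.trans hlt.le)
  obtain ⟨N, hN, hNt⟩ := exists_admissible_affine_posPart_le hM' ha hlam
  have h1 := affine_le_guarantee_meansAtLeast hN.2 ha (fun i => le_max_right _ _) hNt m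
  have h2 : (g : EReal) ≤ N.guarantee (meansAtLeast a m) := by
    refine le_trans ?_ h1
    rw [EReal.coe_le_coe_iff]
    linarith [sum_mul_le_sum_posPart_mul (fun i => (hm i).1) lam]
  exact absurd (h2.trans ((hM.2 N hN).trans (guarantee_meansAtLeast_le M m)))
    (not_le.mpr (hg ▸ hlt))

end RobustAuction

theorem mainTheorem9 (n : ℕ) (hn : 2 ≤ n) (a : ℝ) (ha : 0 < a) (m : Fin n → ℝ)
    (hm : ∀ i, 0 < m i ∧ m i < a) :
    RobustAuction.optimalMechanisms (RobustAuction.meansEqual a m)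
        = RobustAuction.optimalMechanisms (RobustAuction.meansAtLeast a m)
      ∧ ∀ M ∈ RobustAuction.optimalMechanisms (RobustAuction.meansEqual a m),
          (∃ lam : Fin n → ℝ, M.IsDualMultiplier m lam)
            ∧ ∀ lam : Fin n → ℝ, M.IsDualMultiplier m lam → ∀ i, 0 ≤ lam i := by
  refine ⟨(RobustAuction.optimalMechanisms_meansEqual_subset ha.le hm).antisymm
    (RobustAuction.optimalMechanisms_meansAtLeast_subset ha.le hm), fun M hM => ?_⟩
  obtain ⟨g, lam, hg, hlam⟩ := RobustAuction.exists_guarantee_eq_and_affine_le hM.1.2 ha.le hm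
    (RobustAuction.guarantee_nonneg_of_mem_optimalMechanisms ha.le hM)
  have hdual : (g : EReal) ≤ M.dualValue m lam := by
    simpa using RobustAuction.le_dualValue hlam m
  refine ⟨⟨lam, fun mu => ?_⟩, fun mu hmu => ?_⟩
  · exact (RobustAuction.dualValue_le_guarantee hM.1.2 ha.le m mu).trans (hg.le.trans hdual)
  -- Any dual maximizer has value at least `g`, so it too gives a minorant attaining the guarantee.
  · exact RobustAuction.coeff_nonneg_of_mem_optimalMechanisms ha.le (fun i => (hm i).1) hM hg
      (RobustAuction.affine_le_of_le_dualValue (hdual.trans (hmu lam)))
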